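/- Let $\mathbb{D}=\{z\in\mathbb{C}:|z|<1\}$, let $\overline{\mathbb{D}}$ be its closure, and let $\varphi_1,\varphi_2:\mathbb{D}\to\mathbb{D}$ be analytic functions. There exist continuous functions $\omega_1,\omega_2:\overline{\mathbb{D}}\to\overline{\mathbb{D}}$ that are analytic on $\mathbb{D}$ and satisfy $\omega_1(0)=\omega_2(0)=0$, $$\omega_1(z)\varphi_1(\omega_1(z))=\omega_2(z)\varphi_2(\omega_2(z))=\frac{\omega_1(z)\omega_2(z)}{z},\qquad z\in\mathbb{D}\setminus\{0\},\tag{1}$$ and $$\omega_1(z)=z\varphi_2(\omega_2(z)),\qquad \omega_2(z)=z\varphi_1(\omega_1(z)),\qquad z\in\mathbb{D}.\tag{2}$$ The pair $(\omega_1,\omega_2)$ is unique in the following sense. Suppose that $v_1,v_2:\overline{\mathbb{D}}\to\overline{\mathbb{D}}$ are continuous, analytic on $\mathbb{D}$, with $v_1(0)=v_2(0)=0$, and that either (a) $v_1,v_2$ satisfy (2) in place of $\omega_1,\omega_2$, or (b) neither $v_1$ nor $v_2$ vanishes identically on $\mathbb{D}$ and they satisfy (1) in place of $\omega_1,\omega_2$.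 Then $v_1=\omega_1$ and $v_2=\omega_2$ on $\overline{\mathbb{D}}$. Moreover, if $v_1,v_2:\mathbb{D}\to\overline{\mathbb{D}}$ are only assumed to be analytic on $\mathbb{D}$, with $v_1(0)=v_2(0)=0$ and (a) or (b), then $v_j=\omega_j$ on $\mathbb{D}$ for $j=1,2$; thus $v_1$ and $v_2$ extend continuously to the unit circle. (A function as above that vanishes at $0$ maps $\mathbb{D}$ into $\mathbb{D}$, so the compositions are defined.) -/

import Mathlib

open Set Metric

namespace DiskSubordination

/-- `ω` is analytic on the open unit disk, takes values in the closed unit disk there,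
and vanishes at the origin. Values of `ω` outside the open disk are irrelevant. -/
structure IsOpenDiskMap (ω : ℂ → ℂ) : Prop where
  analytic : DifferentiableOn ℂ ω (ball 0 1)
  mapsTo : MapsTo ω (ball 0 1) (closedBall 0 1)
  zero : ω 0 = 0

/-- `ω` is a continuous map of the closed unit disk to itself that is analytic on the open
unit disk and vanishes at the origin. Values of `ω` outside the closed disk are irrelevant. -/
structure IsClosedDiskMap (ω : ℂ → ℂ) : Prop where
  continuousOn : ContinuousOn ω (closedBall 0 1)
  mapsTo : MapsTo ω (closedBall 0 1) (closedBall 0 1)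
  analytic : DifferentiableOn ℂ ω (ball 0 1)
  zero : ω 0 = 0

/-- The relations `ω₁ φ₁(ω₁) = ω₂ φ₂(ω₂) = ω₁ ω₂ / z` on the punctured open disk. -/
def SatisfiesRelation (φ₁ φ₂ ω₁ ω₂ : ℂ → ℂ) : Prop :=
  ∀ z ∈ ball (0 : ℂ) 1, z ≠ 0 →
    ω₁ z * φ₁ (ω₁ z) = ω₂ z * φ₂ (ω₂ z) ∧
    ω₂ z * φ₂ (ω₂ z) = ω₁ z * ω₂ z / z

/-- The system `ω₁ = z φ₂(ω₂)`, `ω₂ = z φ₁(ω₁)` on the open disk. -/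
def SatisfiesSystem (φ₁ φ₂ ω₁ ω₂ : ℂ → ℂ) : Prop :=
  ∀ z ∈ ball (0 : ℂ) 1, ω₁ z = z * φ₂ (ω₂ z) ∧ ω₂ z = z * φ₁ (ω₁ z)

/-- `ω` does not vanish identically on the open disk. -/
def NotIdenticallyZero (ω : ℂ → ℂ) : Prop :=
  ∃ z ∈ ball (0 : ℂ) 1, ω z ≠ 0

/-- A pair of functions solves the subordination problem if it satisfies the system or
if neither function vanishes identically on the disk and the pair satisfies the relations. -/
def IsSubordinationPair (φ₁ φ₂ ω₁ ω₂ : ℂ → ℂ) : Prop :=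
  SatisfiesSystem φ₁ φ₂ ω₁ ω₂ ∨
    (NotIdenticallyZero ω₁ ∧ NotIdenticallyZero ω₂ ∧ SatisfiesRelation φ₁ φ₂ ω₁ ω₂)

end DiskSubordination

/-!
The system says that `ω₁(z)` is a fixed point of `f_z(w) = z φ₂(z φ₁(w))` (`composite`). For
`|z| < 1` this map contracts the pseudo-hyperbolic distance, so it has exactly one fixed point in the
disk, and the iterates of `f_z` starting from `0` converge to it locally uniformly in `z`
(`exists_analytic_fixed_point`, `composite_fixed_unique`). For functions that do not vanish
identically, the relations reduce to the system by the identity theorem (`eq_mul_of_relation`).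

The main point is continuity at a boundary point `ζ` (`exists_boundary_limit`): by compactness, it
suffices that any two limits `a`, `b` of `ω₁` at `ζ` agree (`limit_unique`). By Schwarz-Pick, `f_z`
does not increase `|1 - w̄ u|² / (1 - |u|²)` for its fixed point `w = ω₁(z)`, and this persists in
the limit: `f_ζ` increases neither `q_a(u) = |1 - ā u|² / (1 - |u|²)` nor `q_b` (`IsAttracting`).

* If `f_ζ` is not the identity and `a ≠ b`, then for each `s > 0` the function `q_a + s q_b` has a
  unique minimiser in the disk, which `f_ζ` must fix. A self-map of the disk other than the identity
  has at most one fixed point, so the minimiser does not depend on `s`. Letting `s → 0` shows that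
  it minimises `q_a`, which forces it to be `a`. By symmetry it is also `b`
  (`eq_of_two_attracting`).
* If `f_ζ` is the identity, then `w ↦ ζ φ₁(w)` is a disk automorphism by the equality case of
  Schwarz-Pick, and its inverse is `w ↦ ζ φ₂(w)`. Then `ω₁(tζ)` satisfies an explicit quadratic
  equation which, as `t → 1`, tends to an equation with at most one root in the closed disk
  (`exists_quadratic_of_leftInverse`, `quadratic_zero_unique`).
-/

namespace DiskSubordination

open Filter Topology ComplexConjugate

/-! ### The Schwarz-Pick lemma and disk automorphisms -/

/-- The disk automorphism `w ↦ (w - a) / (1 - ā w)` sending `a` to `0`. -/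
noncomputable def mobius (a w : ℂ) : ℂ := (w - a) / (1 - conj a * w)

theorem one_sub_conj_mul_ne_zero {a w : ℂ} (ha : ‖a‖ ≤ 1) (hw : ‖w‖ < 1) :
    1 - conj a * w ≠ 0 := by
  intro h
  have h1 : ‖conj a * w‖ = 1 := by rw [← sub_eq_zero.1 h, norm_one]
  rw [norm_mul, Complex.norm_conj] at h1
  nlinarith [norm_nonneg a, norm_nonneg w]

theorem norm_one_sub_sq_sub_norm_sub_sq (a w : ℂ) :
    ‖1 - conj a * w‖ ^ 2 - ‖a - w‖ ^ 2 = (1 - ‖a‖ ^ 2) * (1 - ‖w‖ ^ 2) := by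
  simp only [Complex.sq_norm, Complex.normSq_apply, Complex.sub_re, Complex.sub_im, Complex.mul_re,
    Complex.mul_im, Complex.conj_re, Complex.conj_im, Complex.one_re, Complex.one_im]
  ring

theorem one_sub_norm_sq_pos {a : ℂ} (ha : ‖a‖ < 1) : 0 < 1 - ‖a‖ ^ 2 := by
  nlinarith [norm_nonneg a]

theorem norm_mobius (a w : ℂ) : ‖mobius a w‖ = ‖a - w‖ / ‖1 - conj a * w‖ := by
  rw [mobius, norm_div, norm_sub_rev]

theorem norm_mobius_lt_one {a w : ℂ} (ha : ‖a‖ < 1) (hw : ‖w‖ < 1) : ‖mobius a w‖ < 1 := by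
  rw [norm_mobius, div_lt_one (norm_pos_iff.2 (one_sub_conj_mul_ne_zero ha.le hw))]
  refine lt_of_pow_lt_pow_left₀ 2 (norm_nonneg _) ?_
  have := mul_pos (one_sub_norm_sq_pos ha) (one_sub_norm_sq_pos hw)
  linarith [norm_one_sub_sq_sub_norm_sub_sq a w]

theorem mapsTo_mobius {a : ℂ} (ha : ‖a‖ < 1) : MapsTo (mobius a) (ball 0 1) (ball 0 1) := by
  intro w hw
  rw [mem_ball_zero_iff] at hw ⊢
  exact norm_mobius_lt_one ha hw

theorem mobius_self (a : ℂ) : mobius a a = 0 := by simp [mobius]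

theorem mobius_neg_zero (a : ℂ) : mobius (-a) 0 = a := by simp [mobius]

theorem mobius_neg_mobius {a w : ℂ} (ha : ‖a‖ < 1) (hw : ‖w‖ < 1) :
    mobius (-a) (mobius a w) = w := by
  have h1 := one_sub_conj_mul_ne_zero ha.le hw
  have h2 := one_sub_conj_mul_ne_zero ha.le ha
  have h3 : (1 : ℂ) - conj (-a) * mobius a w = (1 - conj a * a) / (1 - conj a * w) := by
    rw [mobius, map_neg, eq_div_iff h1, sub_mul, neg_mul, neg_mul, mul_assoc, div_mul_cancel₀ _ h1]
    ring
  have h4 : mobius a w - -a = w * (1 - conj a * a) / (1 - conj a * w) := by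
    rw [mobius, eq_div_iff h1, sub_mul, div_mul_cancel₀ _ h1]
    ring
  rw [mobius, h3, h4, div_div_div_cancel_right₀ h1, mul_div_cancel_right₀ _ h2]

theorem differentiableOn_mobius {a : ℂ} (ha : ‖a‖ < 1) :
    DifferentiableOn ℂ (mobius a) (ball 0 1) := by
  intro w hw
  have := one_sub_conj_mul_ne_zero ha.le (mem_ball_zero_iff.1 hw)
  unfold mobius
  fun_prop (disch := assumption)

theorem mobius_injOn {a w v : ℂ} (ha : ‖a‖ < 1) (hw : ‖w‖ < 1) (hv : ‖v‖ < 1)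
    (h : mobius a w = mobius a v) : w = v := by
  rw [← mobius_neg_mobius ha hw, h, mobius_neg_mobius ha hv]

theorem mobius_neg_mapsTo {a : ℂ} (ha : ‖a‖ < 1) :
    MapsTo (mobius (-a)) (ball 0 1) (ball 0 1) := mapsTo_mobius (by rwa [norm_neg])

theorem norm_map_lt_one {f : ℂ → ℂ} (hm : MapsTo f (ball 0 1) (ball 0 1)) {a : ℂ}
    (ha : ‖a‖ < 1) : ‖f a‖ < 1 := by
  simpa using hm (mem_ball_zero_iff.2 ha)

section SchwarzPick

variable {f : ℂ → ℂ} (hf : DifferentiableOn ℂ f (ball 0 1)) (hm : MapsTo f (ball 0 1) (ball 0 1))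
  {a w : ℂ} (ha : ‖a‖ < 1) (hw : ‖w‖ < 1)
include hf hm ha

/-- Conjugating a self-map of the disk by disk automorphisms moves the point `a` and its image
to the origin. -/
theorem mobius_conjugate :
    DifferentiableOn ℂ (fun u => mobius (f a) (f (mobius (-a) u))) (ball 0 1) ∧
    MapsTo (fun u => mobius (f a) (f (mobius (-a) u))) (ball 0 1) (ball 0 1) ∧
    mobius (f a) (f (mobius (-a) 0)) = 0 := by
  have hfa := norm_map_lt_one hm ha
  have h1 := mobius_neg_mapsTo ha
  refine ⟨?_, (mapsTo_mobius hfa).comp (hm.comp h1), by rw [mobius_neg_zero, mobius_self]⟩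
  exact (differentiableOn_mobius hfa).comp
    (hf.comp (differentiableOn_mobius (by rwa [norm_neg])) h1) (hm.comp h1)

include hw

/-- The Schwarz-Pick lemma. -/
theorem norm_mobius_map_le : ‖mobius (f a) (f w)‖ ≤ ‖mobius a w‖ := by
  obtain ⟨h1, h2, h3⟩ := mobius_conjugate hf hm ha
  have h := Complex.norm_le_norm_of_mapsTo_ball h1 (h2.mono_right ball_subset_closedBall) h3
    (norm_mobius_lt_one ha hw)
  simpa only [mobius_neg_mobius ha hw] using h

/-- The Schwarz-Pick lemma without denominators. -/
theorem norm_map_sub_mul_le :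
    ‖f a - f w‖ * ‖1 - conj a * w‖ ≤ ‖a - w‖ * ‖1 - conj (f a) * f w‖ := by
  have h := norm_mobius_map_le hf hm ha hw
  have hfa := norm_map_lt_one hm ha
  have hfw := norm_map_lt_one hm hw
  rwa [norm_mobius, norm_mobius, div_le_div_iff₀
    (norm_pos_iff.2 (one_sub_conj_mul_ne_zero hfa.le hfw))
    (norm_pos_iff.2 (one_sub_conj_mul_ne_zero ha.le hw))] at h

/-- The Schwarz-Pick lemma in terms of the complementary quantity
`(1 - |a|²)(1 - |w|²) / |1 - ā w|²`. -/
theorem one_sub_norm_sq_mul_le :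
    (1 - ‖a‖ ^ 2) * (1 - ‖w‖ ^ 2) * ‖1 - conj (f a) * f w‖ ^ 2 ≤
      (1 - ‖f a‖ ^ 2) * (1 - ‖f w‖ ^ 2) * ‖1 - conj a * w‖ ^ 2 := by
  have h := pow_le_pow_left₀ (by positivity) (norm_map_sub_mul_le hf hm ha hw) 2
  rw [← norm_one_sub_sq_sub_norm_sub_sq, ← norm_one_sub_sq_sub_norm_sub_sq]
  nlinarith [h]

/-- The equality case of the Schwarz-Pick lemma: a self-map of the disk preserving one
pseudo-hyperbolic distance is a disk automorphism. -/
theorem exists_mobius_map_eq (hne : a ≠ w) (heq : ‖mobius (f a) (f w)‖ = ‖mobius a w‖) :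
    ∃ c : ℂ, ‖c‖ = 1 ∧ ∀ u, ‖u‖ < 1 → mobius (f a) (f u) = c * mobius a u := by
  obtain ⟨h1, h2, h3⟩ := mobius_conjugate hf hm ha
  have hpt : mobius a w ≠ 0 := by
    intro h
    exact hne (mobius_injOn ha ha hw (by rw [h, mobius_self]))
  have h4 : ‖dslope (fun u => mobius (f a) (f (mobius (-a) u))) 0 (mobius a w)‖ = 1 / 1 := by
    rw [dslope_of_ne _ hpt, slope_def_field, mobius_neg_mobius ha hw, h3, norm_div, sub_zero,
      sub_zero, heq, div_self (norm_ne_zero_iff.2 hpt), div_one]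
  obtain ⟨c, hc, h5⟩ := Complex.affine_of_mapsTo_ball_of_exists_norm_dslope_eq_div' h1
    (by simp only [h3]; exact h2.mono_right ball_subset_closedBall)
    ⟨_, mem_ball_zero_iff.2 (norm_mobius_lt_one ha hw), h4⟩
  refine ⟨c, by simpa using hc, fun u hu => ?_⟩
  have h6 := h5 (mem_ball_zero_iff.2 (norm_mobius_lt_one ha hu))
  simp only [h3, mobius_neg_mobius ha hu] at h6
  rw [h6]
  simp [mul_comm]

end SchwarzPick

/-- A self-map of the disk with two fixed points is the identity. -/
theorem eq_of_two_fixed_points {f : ℂ → ℂ} (hf : DifferentiableOn ℂ f (ball 0 1))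
    (hm : MapsTo f (ball 0 1) (ball 0 1)) {a w : ℂ} (ha : ‖a‖ < 1) (hw : ‖w‖ < 1) (hne : a ≠ w)
    (hfa : f a = a) (hfw : f w = w) {u : ℂ} (hu : ‖u‖ < 1) : f u = u := by
  obtain ⟨c, -, h⟩ := exists_mobius_map_eq hf hm ha hw hne (by rw [hfa, hfw])
  have hpt : mobius a w ≠ 0 := by
    intro h
    exact hne (mobius_injOn ha ha hw (by rw [h, mobius_self]))
  have hc : c = 1 := by
    have := h w hw
    rw [hfa, hfw] at this
    exact mul_right_cancel₀ hpt (by rw [← this, one_mul])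
  have := h u hu
  rw [hfa, hc, one_mul] at this
  exact mobius_injOn ha (norm_map_lt_one hm hu) hu this

/-! ### Solutions inside the disk: iteration and analytic dependence -/

/-- Multiplication by `z` with `|z| ≤ r` contracts the pseudo-hyperbolic distance
`|a - b| / |1 - ā b|` by the factor `2r / (1 + r²)`. -/
theorem norm_one_sub_conj_mul_contract {z a b : ℂ} {r : ℝ} (hz : ‖z‖ ≤ r) (hr : r < 1)
    (ha : ‖a‖ ≤ 1) (hb : ‖b‖ ≤ 1) :
    ‖z‖ * ‖1 - conj a * b‖ ≤ 2 * r / (1 + r ^ 2) * ‖1 - conj (z * a) * (z * b)‖ := by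
  have hz0 := norm_nonneg z
  set t := ‖z‖ with ht
  have hs : ‖conj a * b‖ ≤ 1 := by
    rw [norm_mul, Complex.norm_conj]
    exact mul_le_one₀ ha (norm_nonneg _) hb
  have heq : conj (z * a) * (z * b) = ((t ^ 2 : ℝ) : ℂ) * (conj a * b) := by
    rw [ht, Complex.sq_norm, Complex.normSq_eq_conj_mul_self, map_mul]
    ring
  rw [heq]
  clear_value t
  generalize conj a * b = s at hs
  have key : (1 + t ^ 2) * ‖1 - s‖ ≤ 2 * ‖1 - ((t ^ 2 : ℝ) : ℂ) * s‖ := by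
    refine le_of_sq_le_sq ?_ (by positivity)
    have hq : s.re * s.re + s.im * s.im ≤ 1 := by
      rw [← Complex.normSq_apply, ← Complex.sq_norm]
      nlinarith [norm_nonneg s]
    have hx : -1 ≤ s.re := by nlinarith [mul_self_nonneg s.im]
    rw [mul_pow, mul_pow, Complex.sq_norm, Complex.sq_norm, Complex.normSq_apply,
      Complex.normSq_apply]
    simp only [Complex.sub_re, Complex.sub_im, Complex.one_re, Complex.one_im,
      Complex.re_ofReal_mul, Complex.im_ofReal_mul]
    have h1 : 0 ≤ (1 + s.re) * (1 - t ^ 2) ^ 2 := mul_nonneg (by linarith) (sq_nonneg _)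
    have h2 : 0 ≤ (1 - (s.re * s.re + s.im * s.im)) * ((1 - t ^ 2) * (1 + 3 * t ^ 2)) :=
      mul_nonneg (by linarith) (mul_nonneg (by nlinarith) (by positivity))
    linarith
  have hmono : t * (1 + r ^ 2) ≤ r * (1 + t ^ 2) := by
    have : 0 ≤ (r - t) * (1 - r * t) := mul_nonneg (by linarith) (by nlinarith)
    linarith
  rw [div_mul_eq_mul_div, le_div_iff₀ (by positivity)]
  nlinarith [mul_le_mul_of_nonneg_right hmono (norm_nonneg (1 - s)),
    mul_le_mul_of_nonneg_left key (hz0.trans hz)]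

section Interior

variable {φ φ₁ φ₂ : ℂ → ℂ}

theorem norm_mul_map_lt_one (hm : MapsTo φ (ball 0 1) (ball 0 1)) {z w : ℂ} (hz : ‖z‖ ≤ 1)
    (hw : ‖w‖ < 1) : ‖z * φ w‖ < 1 := by
  rw [norm_mul]
  exact (mul_le_of_le_one_left (norm_nonneg _) hz).trans_lt (norm_map_lt_one hm hw)

/-- If `|z| ≤ r`, then `w ↦ z φ(w)` contracts the pseudo-hyperbolic distance `|a - b| / |1 - ā b|`
by the factor `2r / (1 + r²)`. -/
theorem norm_mul_map_sub_le (hφ : DifferentiableOn ℂ φ (ball 0 1))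
    (hm : MapsTo φ (ball 0 1) (ball 0 1)) {z a b : ℂ} {r c : ℝ} (hz : ‖z‖ ≤ r) (hr : r < 1)
    (ha : ‖a‖ < 1) (hb : ‖b‖ < 1) (hc : 0 ≤ c) (h : ‖a - b‖ ≤ c * ‖1 - conj a * b‖) :
    ‖z * φ a - z * φ b‖ ≤ c * (2 * r / (1 + r ^ 2)) * ‖1 - conj (z * φ a) * (z * φ b)‖ := by
  have hpos := norm_pos_iff.2 (one_sub_conj_mul_ne_zero ha.le hb)
  have h1 : ‖φ a - φ b‖ ≤ c * ‖1 - conj (φ a) * φ b‖ := by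
    refine le_of_mul_le_mul_right ((norm_map_sub_mul_le hφ hm ha hb).trans ?_) hpos
    nlinarith [mul_le_mul_of_nonneg_right h (norm_nonneg (1 - conj (φ a) * φ b))]
  rw [← mul_sub, norm_mul, mul_assoc]
  refine le_trans ?_ (mul_le_mul_of_nonneg_left (norm_one_sub_conj_mul_contract hz hr
    (norm_map_lt_one hm ha).le (norm_map_lt_one hm hb).le) hc)
  nlinarith [mul_le_mul_of_nonneg_left h1 (norm_nonneg z)]

/-- The self-map `w ↦ z φ₂(z φ₁(w))` of the disk, whose fixed points are the values `ω₁(z)` of the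
first components of the solutions of the system. -/
def composite (φ₁ φ₂ : ℂ → ℂ) (z w : ℂ) : ℂ := z * φ₂ (z * φ₁ w)

variable (hφ₁ : DifferentiableOn ℂ φ₁ (ball 0 1)) (hm₁ : MapsTo φ₁ (ball 0 1) (ball 0 1))
  (hφ₂ : DifferentiableOn ℂ φ₂ (ball 0 1)) (hm₂ : MapsTo φ₂ (ball 0 1) (ball 0 1))

include hm₁ hm₂ in
theorem norm_composite_le {z w : ℂ} (hz : ‖z‖ ≤ 1) (hw : ‖w‖ < 1) :
    ‖composite φ₁ φ₂ z w‖ ≤ ‖z‖ := by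
  rw [composite, norm_mul]
  exact mul_le_of_le_one_right (norm_nonneg _)
    (norm_map_lt_one hm₂ (norm_mul_map_lt_one hm₁ hz hw)).le

include hm₁ hm₂ in
theorem mapsTo_composite {z : ℂ} (hz : ‖z‖ ≤ 1) :
    MapsTo (composite φ₁ φ₂ z) (ball 0 1) (ball 0 1) := by
  intro w hw
  rw [mem_ball_zero_iff] at hw ⊢
  exact norm_mul_map_lt_one hm₂ hz (norm_mul_map_lt_one hm₁ hz hw)

include hφ₁ hφ₂ hm₁ in
theorem differentiableOn_composite {z : ℂ} (hz : ‖z‖ ≤ 1) :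
    DifferentiableOn ℂ (composite φ₁ φ₂ z) (ball 0 1) := by
  refine (hφ₂.comp (hφ₁.const_mul z) fun w hw => ?_).const_mul z
  rw [mem_ball_zero_iff] at hw ⊢
  exact norm_mul_map_lt_one hm₁ hz hw

include hφ₁ hφ₂ hm₁ hm₂

theorem composite_fixed_unique {z a b : ℂ} (hz : ‖z‖ < 1) (ha : ‖a‖ < 1) (hb : ‖b‖ < 1)
    (hfa : composite φ₁ φ₂ z a = a) (hfb : composite φ₁ φ₂ z b = b) : a = b := by
  by_contra hne
  obtain ⟨t, ht1, ht2⟩ := exists_between hz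
  have h0 : ‖(t : ℂ)‖ = t := by
    rw [Complex.norm_real, Real.norm_of_nonneg ((norm_nonneg z).trans ht1.le)]
  -- A second fixed point would make the map the identity, but its image lies in `|w| ≤ |z|`.
  have h1 := eq_of_two_fixed_points (differentiableOn_composite hφ₁ hm₁ hφ₂ hz.le)
    (mapsTo_composite hm₁ hm₂ hz.le) ha hb hne hfa hfb (u := (t : ℂ)) (by rwa [h0])
  have h2 := norm_composite_le hm₁ hm₂ hz.le (w := (t : ℂ)) (by rwa [h0])
  rw [h1, h0] at h2
  linarith

omit hφ₁ hφ₂ in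
theorem norm_iterate_composite_le {z : ℂ} (hz : ‖z‖ < 1) (n : ℕ) :
    ‖(composite φ₁ φ₂ z)^[n] 0‖ ≤ ‖z‖ := by
  induction n with
  | zero => simp
  | succ n ih =>
    rw [Function.iterate_succ_apply']
    exact norm_composite_le hm₁ hm₂ hz.le (ih.trans_lt hz)

theorem differentiableOn_iterate_composite (n : ℕ) :
    DifferentiableOn ℂ (fun z => (composite φ₁ φ₂ z)^[n] 0) (ball 0 1) := by
  induction n with
  | zero => simp
  | succ n ih =>
    simp only [Function.iterate_succ_apply', composite]
    have hn : MapsTo (fun z => (composite φ₁ φ₂ z)^[n] 0) (ball 0 1) (ball 0 1) := by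
      intro z hz
      rw [mem_ball_zero_iff] at hz ⊢
      exact (norm_iterate_composite_le hm₁ hm₂ hz n).trans_lt hz
    refine differentiableOn_id.mul (hφ₂.comp (differentiableOn_id.mul (hφ₁.comp ih hn)) ?_)
    intro z hz
    have := hn hz
    rw [mem_ball_zero_iff] at hz this ⊢
    exact norm_mul_map_lt_one hm₁ hz.le this

theorem iterate_composite_sub_le {z : ℂ} {r : ℝ} (hz : ‖z‖ ≤ r) (hr : r < 1) (n : ℕ) :
    ‖(composite φ₁ φ₂ z)^[n] 0 - (composite φ₁ φ₂ z)^[n + 1] 0‖ ≤ ((2 * r / (1 + r ^ 2)) ^ 2) ^ n *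
      ‖1 - conj ((composite φ₁ φ₂ z)^[n] 0) * (composite φ₁ φ₂ z)^[n + 1] 0‖ := by
  have hz1 := hz.trans_lt hr
  have hr0 := (norm_nonneg z).trans hz
  have hlt (n : ℕ) : ‖(composite φ₁ φ₂ z)^[n] 0‖ < 1 :=
    (norm_iterate_composite_le hm₁ hm₂ hz1 n).trans_lt hz1
  induction n with
  | zero => simpa using (hlt 1).le
  | succ n ih =>
    have h1 := norm_mul_map_sub_le hφ₁ hm₁ hz hr (hlt n) (hlt (n + 1)) (by positivity) ih
    have h2 := norm_mul_map_sub_le hφ₂ hm₂ hz hr (norm_mul_map_lt_one hm₁ hz1.le (hlt n))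
      (norm_mul_map_lt_one hm₁ hz1.le (hlt (n + 1))) (by positivity) h1
    rw [Function.iterate_succ_apply' _ (n + 1), Function.iterate_succ_apply' _ n, pow_succ]
    rw [Function.iterate_succ_apply' _ n] at h2
    rw [mul_assoc (_ ^ n), ← sq] at h2
    exact h2

theorem dist_iterate_composite_le {z : ℂ} {r : ℝ} (hz : ‖z‖ ≤ r) (hr : r < 1) (n : ℕ) :
    dist ((composite φ₁ φ₂ z)^[n] 0) ((composite φ₁ φ₂ z)^[n + 1] 0) ≤
      2 * ((2 * r / (1 + r ^ 2)) ^ 2) ^ n := by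
  have hz1 := hz.trans_lt hr
  have hlt (n : ℕ) : ‖(composite φ₁ φ₂ z)^[n] 0‖ < 1 :=
    (norm_iterate_composite_le hm₁ hm₂ hz1 n).trans_lt hz1
  rw [dist_eq_norm, mul_comm]
  refine (iterate_composite_sub_le hφ₁ hm₁ hφ₂ hm₂ hz hr n).trans
    (mul_le_mul_of_nonneg_left ?_ (by positivity))
  refine (norm_sub_le _ _).trans ?_
  rw [norm_one, norm_mul, Complex.norm_conj]
  have := mul_le_one₀ (hlt n).le (norm_nonneg _) (hlt (n + 1)).le
  linarith

omit hφ₁ hφ₂ hm₁ hm₂ in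
theorem contraction_factor_lt_one {r : ℝ} (hr0 : 0 ≤ r) (hr : r < 1) :
    (2 * r / (1 + r ^ 2)) ^ 2 < 1 := by
  refine pow_lt_one₀ (by positivity) ?_ two_ne_zero
  rw [div_lt_one (by positivity)]
  nlinarith [sq_pos_of_pos (sub_pos.2 hr)]

/-- The fixed point of `composite φ₁ φ₂ z` in the disk exists and depends analytically on `z`:
it is the locally uniform limit of the iterates starting from `0`. -/
theorem exists_analytic_fixed_point :
    ∃ ω : ℂ → ℂ, DifferentiableOn ℂ ω (ball 0 1) ∧ MapsTo ω (ball 0 1) (ball 0 1) ∧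
      ∀ z ∈ ball (0 : ℂ) 1, composite φ₁ φ₂ z (ω z) = ω z := by
  have hconv (z : ℂ) : ∃ w, z ∈ ball (0 : ℂ) 1 →
      Tendsto (fun n => (composite φ₁ φ₂ z)^[n] 0) atTop (𝓝 w) := by
    by_cases hz : z ∈ ball (0 : ℂ) 1
    · rw [mem_ball_zero_iff] at hz
      obtain ⟨w, hw⟩ := cauchySeq_tendsto_of_complete (cauchySeq_of_le_geometric _ 2
        (contraction_factor_lt_one (norm_nonneg z) hz)
        (dist_iterate_composite_le hφ₁ hm₁ hφ₂ hm₂ le_rfl hz))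
      exact ⟨w, fun _ => hw⟩
    · exact ⟨0, fun h => absurd h hz⟩
  choose ω hω using hconv
  have hmap : MapsTo ω (ball 0 1) (ball 0 1) := by
    intro z hz
    have h1 := hω z hz
    rw [mem_ball_zero_iff] at hz ⊢
    exact (le_of_tendsto h1.norm (.of_forall fun n =>
      norm_iterate_composite_le hm₁ hm₂ hz n)).trans_lt hz
  refine ⟨ω, fun z hz => ?_, hmap, fun z hz => ?_⟩
  · rw [mem_ball_zero_iff] at hz
    obtain ⟨r, hzr, hr⟩ := exists_between hz
    have hr0 := (norm_nonneg z).trans hzr.le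
    have hK := contraction_factor_lt_one hr0 hr
    set K := (2 * r / (1 + r ^ 2)) ^ 2
    have hunif : TendstoUniformlyOn (fun n z => (composite φ₁ φ₂ z)^[n] 0) ω atTop (ball 0 r) := by
      rw [Metric.tendstoUniformlyOn_iff]
      intro ε hε
      have hlim : Tendsto (fun n : ℕ => 2 * K ^ n / (1 - K)) atTop (𝓝 0) := by
        simpa using ((tendsto_pow_atTop_nhds_zero_of_lt_one (by positivity) hK).const_mul
          2).div_const (1 - K)
      filter_upwards [hlim.eventually_lt_const hε] with n hn x hx
      have hx' := mem_ball_zero_iff.1 hx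
      rw [dist_comm]
      exact (dist_le_of_le_geometric_of_tendsto K 2 hK
        (dist_iterate_composite_le hφ₁ hm₁ hφ₂ hm₂ hx'.le hr)
        (hω x (ball_subset_ball hr.le hx)) n).trans_lt hn
    have hd := hunif.tendstoLocallyUniformlyOn.differentiableOn (.of_forall fun n =>
      (differentiableOn_iterate_composite hφ₁ hm₁ hφ₂ hm₂ n).mono (ball_subset_ball hr.le))
      isOpen_ball
    exact (hd.differentiableAt (isOpen_ball.mem_nhds
      (mem_ball_zero_iff.2 hzr))).differentiableWithinAt
  · have hz' := (mem_ball_zero_iff.1 hz).le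
    have hc := ((differentiableOn_composite hφ₁ hm₁ hφ₂ hz').differentiableAt
      (isOpen_ball.mem_nhds (hmap hz))).continuousAt
    have h1 := hc.tendsto.comp (hω z hz)
    have h2 := (hω z hz).comp (tendsto_add_atTop_nat 1)
    refine tendsto_nhds_unique (h1.congr fun n => ?_) h2
    simp only [Function.comp_apply, Function.iterate_succ_apply']

end Interior

/-! ### Limits at the boundary -/

/-- The point `a` of the closed disk is attracting for the self-map `f` of the open disk if `f` does
not increase `|1 - ā u|² / (1 - |u|²)`. For `|a| < 1` the sublevel sets of this quantity are the
hyperbolic disks centred at `a`, for `|a| = 1` they are the horodisks at `a`. -/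
def IsAttracting (f : ℂ → ℂ) (a : ℂ) : Prop :=
  ∀ u : ℂ, ‖u‖ < 1 →
    (1 - ‖u‖ ^ 2) * ‖1 - conj a * f u‖ ^ 2 ≤ (1 - ‖f u‖ ^ 2) * ‖1 - conj a * u‖ ^ 2

theorem norm_midpoint_sq (x y : ℂ) :
    ‖(x + y) / 2‖ ^ 2 = (‖x‖ ^ 2 + ‖y‖ ^ 2) / 2 - ‖x - y‖ ^ 2 / 4 := by
  have h := parallelogram_law_with_norm ℝ x y
  rw [norm_div, Complex.norm_two]
  linarith

theorem norm_one_sub_mul_midpoint_sq_le (a x y : ℂ) :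
    ‖1 - conj a * ((x + y) / 2)‖ ^ 2 ≤
      (‖1 - conj a * x‖ ^ 2 + ‖1 - conj a * y‖ ^ 2) / 2 := by
  have h := norm_midpoint_sq (1 - conj a * x) (1 - conj a * y)
  have e : (1 - conj a * x + (1 - conj a * y)) / 2 = 1 - conj a * ((x + y) / 2) := by ring
  rw [e] at h
  linarith [sq_nonneg ‖1 - conj a * x - (1 - conj a * y)‖]

/-- If two distinct points are attracting for `f`, then `f` fixes the unique minimiser of any
positive combination of the two associated quantities, since it does not increase the combination. -/
theorem exists_fixed_minimiser {f : ℂ → ℂ} (hm : MapsTo f (ball 0 1) (ball 0 1)) {a b : ℂ}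
    (hne : a ≠ b) (ha : IsAttracting f a) (hb : IsAttracting f b) {s : ℝ} (hs : 0 < s) :
    ∃ u : ℂ, ‖u‖ < 1 ∧ f u = u ∧ ∀ v : ℂ, ‖v‖ < 1 →
      (1 - ‖v‖ ^ 2) * (‖1 - conj a * u‖ ^ 2 + s * ‖1 - conj b * u‖ ^ 2) ≤
        (1 - ‖u‖ ^ 2) * (‖1 - conj a * v‖ ^ 2 + s * ‖1 - conj b * v‖ ^ 2) := by
  set N : ℂ → ℝ := fun u => ‖1 - conj a * u‖ ^ 2 + s * ‖1 - conj b * u‖ ^ 2 with hN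
  have hNpos (u : ℂ) : 0 < N u := by
    by_cases h1 : 1 - conj a * u = 0
    · have h2 : 1 - conj b * u ≠ 0 := by
        intro h2
        have hu : u ≠ 0 := by rintro rfl; simp at h1
        exact hne ((starRingEnd ℂ).injective
          (mul_right_cancel₀ hu ((sub_eq_zero.1 h1).symm.trans (sub_eq_zero.1 h2))))
      have := norm_pos_iff.2 h2
      positivity
    · have := norm_pos_iff.2 h1
      positivity
  have hcont : ContinuousOn (fun u : ℂ => (1 - ‖u‖ ^ 2) / N u) (closedBall 0 1) := by
    refine Continuous.continuousOn (Continuous.div (by fun_prop) (by fun_prop) fun u => (hNpos u).ne')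
  obtain ⟨u, -, hmax⟩ := (isCompact_closedBall (0 : ℂ) 1).exists_isMaxOn
    ⟨0, mem_closedBall_self zero_le_one⟩ hcont
  have hmax' (v : ℂ) (hv : ‖v‖ < 1) : (1 - ‖v‖ ^ 2) * N u ≤ (1 - ‖u‖ ^ 2) * N v := by
    have := hmax (mem_closedBall_zero_iff.2 hv.le)
    rwa [mem_ofPred_eq, div_le_div_iff₀ (hNpos v) (hNpos u)] at this
  have hu : ‖u‖ < 1 := by
    have h0 := hmax' 0 (by simp)
    rw [norm_zero] at h0
    have h1 : 0 < (1 - ‖u‖ ^ 2) * N 0 := lt_of_lt_of_le (by simpa using hNpos u) h0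
    have h2 := (pos_iff_pos_of_mul_pos h1).2 (hNpos 0)
    nlinarith [norm_nonneg u]
  have hfu := norm_map_lt_one hm hu
  refine ⟨u, hu, ?_, hmax'⟩
  by_contra hfix
  -- `f u` is another minimiser, so by strict convexity the midpoint does better than both.
  have h1 : (1 - ‖u‖ ^ 2) * N (f u) ≤ (1 - ‖f u‖ ^ 2) * N u := by
    simp only [hN]
    nlinarith [ha u hu, mul_le_mul_of_nonneg_left (hb u hu) hs.le]
  have hmid1 := norm_midpoint_sq u (f u)
  have hmid2 : N ((u + f u) / 2) ≤ (N u + N (f u)) / 2 := by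
    have h2 := norm_one_sub_mul_midpoint_sq_le a u (f u)
    have h3 := mul_le_mul_of_nonneg_left (norm_one_sub_mul_midpoint_sq_le b u (f u)) hs.le
    simp only [hN]
    linarith
  have hd : 0 < ‖u - f u‖ ^ 2 := by
    have := norm_pos_iff.2 (sub_ne_zero.2 (Ne.symm hfix))
    positivity
  have hlt : ‖(u + f u) / 2‖ < 1 := by
    rw [norm_div, Complex.norm_two]
    linarith [norm_add_le u (f u)]
  have h4 := hmax' _ hlt
  rw [hmid1] at h4
  nlinarith [mul_le_mul_of_nonneg_left hmid2 (one_sub_norm_sq_pos hu).le, mul_pos hd (hNpos u)]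

/-- The quantity `|1 - ā u|² / (1 - |u|²)` has no minimiser in the open disk other than `a`. -/
theorem eq_of_forall_minimiser {a u : ℂ} (ha : ‖a‖ ≤ 1) (hu : ‖u‖ < 1)
    (h : ∀ v : ℂ, ‖v‖ < 1 →
      (1 - ‖v‖ ^ 2) * ‖1 - conj a * u‖ ^ 2 ≤ (1 - ‖u‖ ^ 2) * ‖1 - conj a * v‖ ^ 2) : a = u := by
  have hP := one_sub_norm_sq_pos hu
  rcases ha.lt_or_eq with ha | ha
  · have h1 := h a ha
    have h2 := norm_one_sub_sq_sub_norm_sub_sq a a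
    have h3 := norm_one_sub_sq_sub_norm_sub_sq a u
    rw [sub_self, norm_zero] at h2
    have hPa := one_sub_norm_sq_pos ha
    have h4 : ‖1 - conj a * u‖ ^ 2 ≤ (1 - ‖u‖ ^ 2) * (1 - ‖a‖ ^ 2) := by
      refine le_of_mul_le_mul_left ?_ hPa
      nlinarith
    have h5 : ‖a - u‖ ^ 2 = 0 := le_antisymm (by linarith) (sq_nonneg _)
    exact sub_eq_zero.1 (norm_eq_zero.1 (pow_eq_zero_iff two_ne_zero |>.1 h5))
  · exfalso
    have hX : 0 < ‖1 - conj a * u‖ ^ 2 :=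
      pow_pos (norm_pos_iff.2 (one_sub_conj_mul_ne_zero ha.le hu)) 2
    set X := ‖1 - conj a * u‖ ^ 2
    -- Along the radius `v = t a` the quantity equals `(1 - t) / (1 + t)`, which tends to `0`.
    obtain ⟨t, ht, ht1⟩ := exists_between (max_lt zero_lt_one (sub_lt_self 1 hX))
    obtain ⟨ht0, htX⟩ := max_lt_iff.1 ht
    have hv : ‖(t : ℂ) * a‖ = t := by
      rw [norm_mul, ha, mul_one, Complex.norm_real, Real.norm_of_nonneg ht0.le]
    have h1 := h (t * a) (by rwa [hv])
    have h2 : 1 - conj a * (t * a) = ((1 - t : ℝ) : ℂ) := by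
      have : conj a * a = 1 := by
        rw [← Complex.normSq_eq_conj_mul_self, ← Complex.sq_norm, ha]; simp
      push_cast
      linear_combination (-(t : ℂ)) * this
    rw [hv, h2, Complex.norm_real, Real.norm_of_nonneg (by linarith)] at h1
    have h3 : (1 + t) * X ≤ (1 - ‖u‖ ^ 2) * (1 - t) := by
      refine le_of_mul_le_mul_left ?_ (sub_pos.2 ht1)
      linarith
    nlinarith [sq_nonneg ‖u‖, mul_pos ht0 hX]

/-- If two distinct points of the closed disk are attracting for a self-map of the disk other than
the identity, then each of them lies in the open disk and is fixed. -/
theorem fixed_of_two_attracting {f : ℂ → ℂ} (hf : DifferentiableOn ℂ f (ball 0 1))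
    (hm : MapsTo f (ball 0 1) (ball 0 1)) (hid : ∃ u, ‖u‖ < 1 ∧ f u ≠ u) {a b : ℂ}
    (ha1 : ‖a‖ ≤ 1) (hne : a ≠ b) (ha : IsAttracting f a) (hb : IsAttracting f b) :
    ‖a‖ < 1 ∧ f a = a := by
  obtain ⟨x, hx, hfx⟩ := hid
  obtain ⟨u, hu, hfu, -⟩ := exists_fixed_minimiser hm hne ha hb one_pos
  have hau : a = u := by
    refine eq_of_forall_minimiser ha1 hu fun v hv => ?_
    have hs : ∀ s : ℝ, 0 < s →
        (1 - ‖v‖ ^ 2) * (‖1 - conj a * u‖ ^ 2 + s * ‖1 - conj b * u‖ ^ 2) ≤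
          (1 - ‖u‖ ^ 2) * (‖1 - conj a * v‖ ^ 2 + s * ‖1 - conj b * v‖ ^ 2) := by
      intro s hs
      obtain ⟨u', hu', hfu', h⟩ := exists_fixed_minimiser hm hne ha hb hs
      -- All minimisers are fixed points, so they do not depend on `s`.
      have : u' = u := by
        by_contra hne'
        exact hfx (eq_of_two_fixed_points hf hm hu' hu hne' hfu' hfu hx)
      subst this
      exact h v hv
    have hlim (p q r : ℝ) : Tendsto (fun s : ℝ => p * (q + s * r)) (𝓝[>] 0) (𝓝 (p * q)) := by
      have : Continuous fun s : ℝ => p * (q + s * r) := by fun_prop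
      simpa using (this.tendsto 0).mono_left nhdsWithin_le_nhds
    refine le_of_tendsto_of_tendsto (hlim _ _ (‖1 - conj b * u‖ ^ 2))
      (hlim _ _ (‖1 - conj b * v‖ ^ 2)) ?_
    filter_upwards [self_mem_nhdsWithin] with s hs0 using hs s hs0
  subst hau
  exact ⟨hu, hfu⟩

theorem eq_of_two_attracting {f : ℂ → ℂ} (hf : DifferentiableOn ℂ f (ball 0 1))
    (hm : MapsTo f (ball 0 1) (ball 0 1)) (hid : ∃ u, ‖u‖ < 1 ∧ f u ≠ u) {a b : ℂ}
    (ha1 : ‖a‖ ≤ 1) (hb1 : ‖b‖ ≤ 1) (ha : IsAttracting f a) (hb : IsAttracting f b) : a = b := by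
  by_contra hne
  obtain ⟨h1, h2⟩ := fixed_of_two_attracting hf hm hid ha1 hne ha hb
  obtain ⟨h3, h4⟩ := fixed_of_two_attracting hf hm hid hb1 (Ne.symm hne) hb ha
  obtain ⟨u, hu, hfu⟩ := hid
  exact hfu (eq_of_two_fixed_points hf hm h1 h3 hne h2 h4 hu)

/-- A self-map `B` of the disk with a left inverse `A` is a disk automorphism
`w ↦ (c w + β) / (1 + β̄ c w)`. Therefore the solutions of `w = t A(x)`, `x = t B(w)` are
the zeros of a quadratic polynomial in `c w` whose coefficients are continuous in `t`. -/
theorem exists_quadratic_of_leftInverse {A B : ℂ → ℂ} (hA : DifferentiableOn ℂ A (ball 0 1))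
    (hmA : MapsTo A (ball 0 1) (ball 0 1)) (hB : DifferentiableOn ℂ B (ball 0 1))
    (hmB : MapsTo B (ball 0 1) (ball 0 1)) (hAB : ∀ w, ‖w‖ < 1 → A (B w) = w) :
    ∃ c β : ℂ, c ≠ 0 ∧ ‖c‖ = 1 ∧ ‖β‖ < 1 ∧ ∀ t w x : ℂ, ‖t‖ < 1 → ‖w‖ < 1 → ‖x‖ < 1 →
      w = t * A x → x = t * B w → (1 + t) * (c * w) + β * t + conj β * (c * w) ^ 2 = 0 := by
  have h0 : ‖(0 : ℂ)‖ < 1 := by simp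
  have h2 : ‖(1 / 2 : ℂ)‖ < 1 := by rw [norm_div, norm_one, Complex.norm_two]; norm_num
  have hβ := norm_map_lt_one hmB h0
  obtain ⟨c, hc, h⟩ := exists_mobius_map_eq hB hmB h0 h2 (by norm_num)
    (le_antisymm (norm_mobius_map_le hB hmB h0 h2) (by
      have := norm_mobius_map_le hA hmA hβ (norm_map_lt_one hmB h2)
      rwa [hAB _ h0, hAB _ h2] at this))
  have hc0 : c ≠ 0 := by rw [← norm_pos_iff, hc]; exact one_pos
  set β := B 0
  have hmob0 (u : ℂ) : mobius 0 u = u := by simp [mobius]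
  have hBeq (u : ℂ) (hu : ‖u‖ < 1) : B u = mobius (-β) (c * u) := by
    rw [← mobius_neg_mobius hβ (norm_map_lt_one hmB hu), h u hu, hmob0]
  refine ⟨c, β, hc0, hc, hβ, fun t w x ht hw hx hwx hxw => ?_⟩
  -- The point `y / c` is the preimage of `x` under `B`.
  set y := mobius β x with hy
  have hy1 : ‖y‖ < 1 := norm_mobius_lt_one hβ hx
  have hp1 : ‖y / c‖ < 1 := by rwa [norm_div, hc, div_one]
  have hBp : B (y / c) = x := by
    rw [hBeq _ hp1, mul_div_cancel₀ _ hc0, hy, mobius_neg_mobius hβ hx]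
  have hAx : A x = y / c := by rw [← hBp, hAB _ hp1]
  have hcw : c * w = t * y := by rw [hwx, hAx]; field_simp
  have hcw1 : ‖c * w‖ < 1 := by rwa [norm_mul, hc, one_mul]
  have heq : mobius (-β) y = t * mobius (-β) (t * y) := by
    rw [hy, mobius_neg_mobius hβ hx, ← hy, ← hcw, ← hBeq w hw, ← hxw]
  have hnβ : ‖-β‖ ≤ 1 := by rw [norm_neg]; exact hβ.le
  have hd1 := one_sub_conj_mul_ne_zero hnβ hy1
  have hd2 := one_sub_conj_mul_ne_zero hnβ (hcw ▸ hcw1)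
  rw [mobius, mobius, ← mul_div_assoc, div_eq_div_iff hd1 hd2] at heq
  have ht1 : 1 - t ≠ 0 := by
    intro h1
    rw [← sub_eq_zero.1 h1, norm_one] at ht
    exact lt_irrefl _ ht
  rw [map_neg] at heq
  have hquad : (1 - t) * ((1 + t) * y + β + conj β * t * y ^ 2) = 0 := by
    linear_combination heq
  have := (mul_eq_zero.1 hquad).resolve_left ht1
  rw [hcw]
  linear_combination t * this

/-- The limiting quadratic has at most one zero in the closed disk: its zeros add up to `-2 / β̄`. -/
theorem quadratic_zero_unique {β y y' : ℂ} (hβ : ‖β‖ < 1) (hy : ‖y‖ ≤ 1) (hy' : ‖y'‖ ≤ 1)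
    (h : 2 * y + β + conj β * y ^ 2 = 0) (h' : 2 * y' + β + conj β * y' ^ 2 = 0) : y = y' := by
  have h1 : (y - y') * (2 + conj β * (y + y')) = 0 := by linear_combination h - h'
  rcases mul_eq_zero.1 h1 with h2 | h2
  · exact sub_eq_zero.1 h2
  · exfalso
    have h3 : ‖conj β * (y + y')‖ = 2 := by
      rw [← Complex.norm_two, ← norm_neg (2 : ℂ), eq_neg_of_add_eq_zero_right h2]
    rw [norm_mul, Complex.norm_conj] at h3
    nlinarith [norm_add_le y y', norm_nonneg β, norm_nonneg (y + y')]

section Boundary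

variable {φ₁ φ₂ ω₁ ω₂ : ℂ → ℂ}
  (hφ₁ : DifferentiableOn ℂ φ₁ (ball 0 1)) (hm₁ : MapsTo φ₁ (ball 0 1) (ball 0 1))
  (hφ₂ : DifferentiableOn ℂ φ₂ (ball 0 1)) (hm₂ : MapsTo φ₂ (ball 0 1) (ball 0 1))
  (hω₁ : MapsTo ω₁ (ball 0 1) (ball 0 1)) (hω₂ : MapsTo ω₂ (ball 0 1) (ball 0 1))
  (hsys : SatisfiesSystem φ₁ φ₂ ω₁ ω₂)
include hφ₁ hm₁ hφ₂ hm₂ hω₁ hsys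

/-- Every limit of `ω₁` at a boundary point `ζ` is attracting for the map
`w ↦ ζ φ₂(ζ φ₁(w))`. -/
theorem isAttracting_of_tendsto {ζ a : ℂ} (hζ : ‖ζ‖ = 1) {F : Filter ℂ} [F.NeBot]
    (hF : F ≤ 𝓝[ball 0 1] ζ) (ha : Tendsto ω₁ F (𝓝 a)) :
    IsAttracting (composite φ₁ φ₂ ζ) a := by
  intro u hu
  have hid : Tendsto (fun z : ℂ => z) F (𝓝 ζ) := hF.trans nhdsWithin_le_nhds
  have hc : Tendsto (fun z => composite φ₁ φ₂ z u) F (𝓝 (composite φ₁ φ₂ ζ u)) := by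
    have h1 : ContinuousAt φ₂ (ζ * φ₁ u) := (hφ₂.differentiableAt (isOpen_ball.mem_nhds
      (mem_ball_zero_iff.2 (norm_mul_map_lt_one hm₁ hζ.le hu)))).continuousAt
    exact hid.mul (h1.tendsto.comp (hid.mul_const _))
  have hconj : Tendsto (fun z => conj (ω₁ z)) F (𝓝 (conj a)) :=
    (Complex.continuous_conj.tendsto a).comp ha
  refine le_of_tendsto_of_tendsto
    (((tendsto_const_nhds (x := (1 : ℂ))).sub (hconj.mul hc)).norm.pow 2 |>.const_mul (1 - ‖u‖ ^ 2))
    (((tendsto_const_nhds (x := (1 : ℝ))).sub (hc.norm.pow 2)).mul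
      (((tendsto_const_nhds (x := (1 : ℂ))).sub (hconj.mul_const u)).norm.pow 2)) ?_
  filter_upwards [hF self_mem_nhdsWithin] with z hz
  have hz1 := mem_ball_zero_iff.1 hz
  have hw := norm_map_lt_one hω₁ hz1
  have hfix : composite φ₁ φ₂ z (ω₁ z) = ω₁ z := by
    rw [composite, ← (hsys z hz).2, ← (hsys z hz).1]
  have h := one_sub_norm_sq_mul_le (differentiableOn_composite hφ₁ hm₁ hφ₂ hz1.le)
    (mapsTo_composite hm₁ hm₂ hz1.le) hw hu
  rw [hfix, mul_assoc, mul_assoc] at h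
  exact le_of_mul_le_mul_left h (one_sub_norm_sq_pos hw)

include hω₂

/-- Any two limits of `ω₁` at a boundary point agree: if `w ↦ ζ φ₂(ζ φ₁(w))` is not the identity,
they are both attracting; otherwise they are zeros of the same quadratic. -/
theorem limit_unique {ζ a b : ℂ} (hζ : ‖ζ‖ = 1) {F G : Filter ℂ} [F.NeBot] [G.NeBot]
    (hF : F ≤ 𝓝[ball 0 1] ζ) (hG : G ≤ 𝓝[ball 0 1] ζ)
    (ha : Tendsto ω₁ F (𝓝 a)) (hb : Tendsto ω₁ G (𝓝 b)) : a = b := by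
  have hle {F : Filter ℂ} [F.NeBot] {a : ℂ} (hF : F ≤ 𝓝[ball 0 1] ζ)
      (ha : Tendsto ω₁ F (𝓝 a)) : ‖a‖ ≤ 1 := by
    refine le_of_tendsto ha.norm ?_
    filter_upwards [hF self_mem_nhdsWithin] with z hz
    exact (norm_map_lt_one hω₁ (mem_ball_zero_iff.1 hz)).le
  by_cases hid : ∃ u, ‖u‖ < 1 ∧ composite φ₁ φ₂ ζ u ≠ u
  · exact eq_of_two_attracting (differentiableOn_composite hφ₁ hm₁ hφ₂ hζ.le)
      (mapsTo_composite hm₁ hm₂ hζ.le) hid (hle hF ha) (hle hG hb)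
      (isAttracting_of_tendsto hφ₁ hm₁ hφ₂ hm₂ hω₁ hsys hζ hF ha)
      (isAttracting_of_tendsto hφ₁ hm₁ hφ₂ hm₂ hω₁ hsys hζ hG hb)
  · push Not at hid
    have hmζ {φ : ℂ → ℂ} (hm : MapsTo φ (ball 0 1) (ball 0 1)) :
        MapsTo (fun w => ζ * φ w) (ball 0 1) (ball 0 1) := by
      intro w hw
      rw [mem_ball_zero_iff] at hw ⊢
      exact norm_mul_map_lt_one hm hζ.le hw
    obtain ⟨c, β, hc0, hc, hβ, h⟩ := exists_quadratic_of_leftInverse (hφ₂.const_mul ζ) (hmζ hm₂)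
      (hφ₁.const_mul ζ) (hmζ hm₁) hid
    have hζ0 : ζ ≠ 0 := by rw [← norm_pos_iff, hζ]; exact one_pos
    have hlim {F : Filter ℂ} [F.NeBot] {a : ℂ} (hF : F ≤ 𝓝[ball 0 1] ζ)
        (ha : Tendsto ω₁ F (𝓝 a)) : 2 * (c * a) + β + conj β * (c * a) ^ 2 = 0 := by
      have ht : Tendsto (fun z : ℂ => z / ζ) F (𝓝 1) := by
        have hz : Tendsto (fun z : ℂ => z) F (𝓝 ζ) := hF.trans nhdsWithin_le_nhds
        have := Tendsto.div_const hz ζ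
        rwa [div_self hζ0] at this
      have hlim1 := (((ht.const_add 1).mul (ha.const_mul c)).add (ht.const_mul β)).add
        (((ha.const_mul c).pow 2).const_mul (conj β))
      rw [one_add_one_eq_two, mul_one] at hlim1
      refine tendsto_nhds_unique (hlim1.congr' ?_) tendsto_const_nhds
      filter_upwards [hF self_mem_nhdsWithin] with z hz
      have hz1 := mem_ball_zero_iff.1 hz
      refine h (z / ζ) (ω₁ z) (ω₂ z) (by rwa [norm_div, hζ, div_one]) (norm_map_lt_one hω₁ hz1)
        (norm_map_lt_one hω₂ hz1) ?_ ?_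
      · rw [← mul_assoc, div_mul_cancel₀ _ hζ0]
        exact (hsys z hz).1
      · rw [← mul_assoc, div_mul_cancel₀ _ hζ0]
        exact (hsys z hz).2
    refine mul_left_cancel₀ hc0 (quadratic_zero_unique hβ ?_ ?_ (hlim hF ha) (hlim hG hb))
    · rw [norm_mul, hc, one_mul]; exact hle hF ha
    · rw [norm_mul, hc, one_mul]; exact hle hG hb

/-- The first component of a solution of the system has a limit at every boundary point. -/
theorem exists_boundary_limit {ζ : ℂ} (hζ : ‖ζ‖ = 1) :
    ∃ a, Tendsto ω₁ (𝓝[ball 0 1] ζ) (𝓝 a) := by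
  have hne : (𝓝[ball (0 : ℂ) 1] ζ).NeBot := by
    rw [← mem_closure_iff_nhdsWithin_neBot, closure_ball _ one_ne_zero, mem_closedBall_zero_iff]
    exact hζ.le
  have hev : ∀ᶠ z in 𝓝[ball (0 : ℂ) 1] ζ, ω₁ z ∈ closedBall (0 : ℂ) 1 := by
    filter_upwards [self_mem_nhdsWithin] with z hz using ball_subset_closedBall (hω₁ hz)
  have hcpt := isCompact_closedBall (0 : ℂ) 1
  obtain ⟨a, -, ha⟩ := hcpt.exists_mapClusterPt_of_frequently hev.frequently
  refine ⟨a, hcpt.tendsto_nhds_of_unique_mapClusterPt hev fun b _ hb => ?_⟩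
  obtain ⟨U, hU, hUa⟩ := mapClusterPt_iff_ultrafilter.1 ha
  obtain ⟨V, hV, hVb⟩ := mapClusterPt_iff_ultrafilter.1 hb
  exact limit_unique hφ₁ hm₁ hφ₂ hm₂ hω₁ hω₂ hsys hζ hV hU hVb hUa

end Boundary

/-! ### Uniqueness and extension to the closed disk -/

theorem IsClosedDiskMap.isOpenDiskMap {ω : ℂ → ℂ} (h : IsClosedDiskMap ω) : IsOpenDiskMap ω :=
  ⟨h.analytic, h.mapsTo.mono_left ball_subset_closedBall, h.zero⟩

theorem IsOpenDiskMap.mapsTo_ball {ω : ℂ → ℂ} (h : IsOpenDiskMap ω) :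
    MapsTo ω (ball 0 1) (ball 0 1) := by
  intro z hz
  rw [mem_ball_zero_iff] at hz ⊢
  exact (Complex.norm_le_norm_of_mapsTo_ball h.analytic h.mapsTo h.zero hz).trans_lt hz

theorem exists_isClosedDiskMap_extension {ω : ℂ → ℂ} (hω : DifferentiableOn ℂ ω (ball 0 1))
    (hm : MapsTo ω (ball 0 1) (ball 0 1)) (h0 : ω 0 = 0)
    (hlim : ∀ ζ : ℂ, ‖ζ‖ = 1 → ∃ a, Tendsto ω (𝓝[ball 0 1] ζ) (𝓝 a)) :
    ∃ Ω : ℂ → ℂ, IsClosedDiskMap Ω ∧ EqOn Ω ω (ball 0 1) := by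
  have hcl : closure (ball (0 : ℂ) 1) = closedBall 0 1 := closure_ball _ one_ne_zero
  have heq : EqOn (extendFrom (ball 0 1) ω) ω (ball 0 1) := extendFrom_extends hω.continuousOn
  have hcont : ContinuousOn (extendFrom (ball 0 1) ω) (closedBall 0 1) := by
    refine continuousOn_extendFrom hcl.ge fun ζ hζ => ?_
    rcases (mem_closedBall_zero_iff.1 hζ).lt_or_eq with h | h
    · exact ⟨ω ζ, hω.continuousOn ζ (mem_ball_zero_iff.2 h)⟩
    · exact hlim ζ h
  refine ⟨_, ⟨hcont, ?_, hω.congr heq, by rw [heq (mem_ball_self one_pos), h0]⟩, heq⟩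
  have hmaps : MapsTo (extendFrom (ball 0 1) ω) (ball 0 1) (ball 0 1) := hm.congr heq.symm
  simpa only [hcl] using hmaps.closure_of_continuousOn (hcont.mono hcl.le)

theorem SatisfiesSystem.symm {φ₁ φ₂ ω₁ ω₂ : ℂ → ℂ} (h : SatisfiesSystem φ₁ φ₂ ω₁ ω₂) :
    SatisfiesSystem φ₂ φ₁ ω₂ ω₁ := fun z hz => (h z hz).symm

theorem SatisfiesSystem.congr {φ₁ φ₂ ω₁ ω₂ Ω₁ Ω₂ : ℂ → ℂ} (h : SatisfiesSystem φ₁ φ₂ ω₁ ω₂)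
    (h₁ : EqOn Ω₁ ω₁ (ball 0 1)) (h₂ : EqOn Ω₂ ω₂ (ball 0 1)) :
    SatisfiesSystem φ₁ φ₂ Ω₁ Ω₂ := by
  intro z hz
  rw [h₁ hz, h₂ hz]
  exact h z hz

theorem SatisfiesSystem.satisfiesRelation {φ₁ φ₂ ω₁ ω₂ : ℂ → ℂ}
    (h : SatisfiesSystem φ₁ φ₂ ω₁ ω₂) : SatisfiesRelation φ₁ φ₂ ω₁ ω₂ := by
  intro z hz hz0
  obtain ⟨h1, h2⟩ := h z hz
  have h3 : φ₂ (ω₂ z) = ω₁ z / z := by rw [eq_div_iff hz0, mul_comm, ← h1]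
  have h4 : φ₁ (ω₁ z) = ω₂ z / z := by rw [eq_div_iff hz0, mul_comm, ← h2]
  rw [h3, h4]
  constructor <;> ring

/-- If `v₂` is not identically zero, then `v₂` can be cancelled from the relation
`v₂ φ₂(v₂) = v₁ v₂ / z`, by the identity theorem. -/
theorem eq_mul_of_relation {φ v₁ v₂ : ℂ → ℂ} (hφ : DifferentiableOn ℂ φ (ball 0 1))
    (h₁ : IsOpenDiskMap v₁) (h₂ : IsOpenDiskMap v₂) (hne : NotIdenticallyZero v₂)
    (h : ∀ z ∈ ball (0 : ℂ) 1, z ≠ 0 → v₂ z * φ (v₂ z) = v₁ z * v₂ z / z)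
    {z : ℂ} (hz : z ∈ ball (0 : ℂ) 1) : v₁ z = z * φ (v₂ z) := by
  have hd : DifferentiableOn ℂ (fun z => v₁ z - z * φ (v₂ z)) (ball 0 1) :=
    h₁.analytic.sub (differentiableOn_id.mul (hφ.comp h₂.analytic h₂.mapsTo_ball))
  have hprod : ∀ z ∈ ball (0 : ℂ) 1, v₂ z * (v₁ z - z * φ (v₂ z)) = 0 := by
    intro z hz
    rcases eq_or_ne z 0 with rfl | hz0
    · rw [h₂.zero, zero_mul]
    · have h3 := h z hz hz0
      rw [eq_div_iff hz0] at h3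
      linear_combination -h3
  rcases (h₂.analytic.analyticOnNhd isOpen_ball).eq_zero_or_eq_zero_of_mul_eq_zero
    (hd.analyticOnNhd isOpen_ball) hprod (convex_ball _ _).isPreconnected with h3 | h3
  · obtain ⟨w, hw, hw0⟩ := hne
    exact absurd (h3 w hw) hw0
  · exact sub_eq_zero.1 (h3 z hz)

theorem IsSubordinationPair.satisfiesSystem {φ₁ φ₂ v₁ v₂ : ℂ → ℂ}
    (hφ₁ : DifferentiableOn ℂ φ₁ (ball 0 1)) (hφ₂ : DifferentiableOn ℂ φ₂ (ball 0 1))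
    (h₁ : IsOpenDiskMap v₁) (h₂ : IsOpenDiskMap v₂) (h : IsSubordinationPair φ₁ φ₂ v₁ v₂) :
    SatisfiesSystem φ₁ φ₂ v₁ v₂ := by
  rcases h with h | ⟨hn₁, hn₂, h⟩
  · exact h
  · intro z hz
    refine ⟨eq_mul_of_relation hφ₂ h₁ h₂ hn₂ (fun z hz hz0 => (h z hz hz0).2) hz,
      eq_mul_of_relation hφ₁ h₂ h₁ hn₁ (fun z hz hz0 => ?_) hz⟩
    rw [(h z hz hz0).1, (h z hz hz0).2, mul_comm (v₁ z)]

theorem SatisfiesSystem.eqOn {φ₁ φ₂ v₁ v₂ ω₁ ω₂ : ℂ → ℂ}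
    (hφ₁ : DifferentiableOn ℂ φ₁ (ball 0 1)) (hm₁ : MapsTo φ₁ (ball 0 1) (ball 0 1))
    (hφ₂ : DifferentiableOn ℂ φ₂ (ball 0 1)) (hm₂ : MapsTo φ₂ (ball 0 1) (ball 0 1))
    (hv : MapsTo v₁ (ball 0 1) (ball 0 1)) (hω : MapsTo ω₁ (ball 0 1) (ball 0 1))
    (h : SatisfiesSystem φ₁ φ₂ v₁ v₂) (h' : SatisfiesSystem φ₁ φ₂ ω₁ ω₂) :
    EqOn v₁ ω₁ (ball 0 1) := by
  intro z hz
  have hz1 := mem_ball_zero_iff.1 hz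
  refine composite_fixed_unique hφ₁ hm₁ hφ₂ hm₂ hz1 (norm_map_lt_one hv hz1)
    (norm_map_lt_one hω hz1) ?_ ?_
  · rw [composite, ← (h z hz).2, ← (h z hz).1]
  · rw [composite, ← (h' z hz).2, ← (h' z hz).1]

end DiskSubordination

open DiskSubordination in
theorem corollary3p3 (φ₁ φ₂ : ℂ → ℂ)
    (hφ₁ : DifferentiableOn ℂ φ₁ (ball 0 1)) (hφ₁_maps : MapsTo φ₁ (ball 0 1) (ball 0 1))
    (hφ₂ : DifferentiableOn ℂ φ₂ (ball 0 1)) (hφ₂_maps : MapsTo φ₂ (ball 0 1) (ball 0 1)) :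
    ∃ ω₁ ω₂ : ℂ → ℂ,
      DiskSubordination.IsClosedDiskMap ω₁ ∧ DiskSubordination.IsClosedDiskMap ω₂ ∧
      DiskSubordination.SatisfiesRelation φ₁ φ₂ ω₁ ω₂ ∧
      DiskSubordination.SatisfiesSystem φ₁ φ₂ ω₁ ω₂ ∧
      (∀ v₁ v₂ : ℂ → ℂ,
        DiskSubordination.IsClosedDiskMap v₁ → DiskSubordination.IsClosedDiskMap v₂ →
        DiskSubordination.IsSubordinationPair φ₁ φ₂ v₁ v₂ →
        EqOn v₁ ω₁ (closedBall 0 1) ∧ EqOn v₂ ω₂ (closedBall 0 1)) ∧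
      (∀ v₁ v₂ : ℂ → ℂ,
        DiskSubordination.IsOpenDiskMap v₁ → DiskSubordination.IsOpenDiskMap v₂ →
        DiskSubordination.IsSubordinationPair φ₁ φ₂ v₁ v₂ →
        EqOn v₁ ω₁ (ball 0 1) ∧ EqOn v₂ ω₂ (ball 0 1)) := by
  obtain ⟨w₁, hd₁, hw₁, hfix⟩ := exists_analytic_fixed_point hφ₁ hφ₁_maps hφ₂ hφ₂_maps
  set w₂ : ℂ → ℂ := fun z => z * φ₁ (w₁ z) with hw₂_def
  have hd₂ : DifferentiableOn ℂ w₂ (ball 0 1) := differentiableOn_id.mul (hφ₁.comp hd₁ hw₁)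
  have hw₂ : MapsTo w₂ (ball 0 1) (ball 0 1) := by
    intro z hz
    rw [mem_ball_zero_iff] at hz ⊢
    exact norm_mul_map_lt_one hφ₁_maps hz.le (norm_map_lt_one hw₁ hz)
  have hsys : SatisfiesSystem φ₁ φ₂ w₁ w₂ := fun z hz => ⟨(hfix z hz).symm, rfl⟩
  obtain ⟨ω₁, hω₁, heq₁⟩ := exists_isClosedDiskMap_extension hd₁ hw₁
    (by simpa using (hsys 0 (mem_ball_self one_pos)).1)
    fun ζ hζ => exists_boundary_limit hφ₁ hφ₁_maps hφ₂ hφ₂_maps hw₁ hw₂ hsys hζ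
  obtain ⟨ω₂, hω₂, heq₂⟩ := exists_isClosedDiskMap_extension hd₂ hw₂ (by simp [hw₂_def])
    fun ζ hζ => exists_boundary_limit hφ₂ hφ₂_maps hφ₁ hφ₁_maps hw₂ hw₁ hsys.symm hζ
  have hsys' := hsys.congr heq₁ heq₂
  have huniq (v₁ v₂ : ℂ → ℂ) (h₁ : IsOpenDiskMap v₁) (h₂ : IsOpenDiskMap v₂)
      (h : IsSubordinationPair φ₁ φ₂ v₁ v₂) :
      EqOn v₁ ω₁ (ball 0 1) ∧ EqOn v₂ ω₂ (ball 0 1) := by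
    have hv := h.satisfiesSystem hφ₁ hφ₂ h₁ h₂
    exact ⟨hv.eqOn hφ₁ hφ₁_maps hφ₂ hφ₂_maps h₁.mapsTo_ball hω₁.isOpenDiskMap.mapsTo_ball hsys',
      hv.symm.eqOn hφ₂ hφ₂_maps hφ₁ hφ₁_maps h₂.mapsTo_ball hω₂.isOpenDiskMap.mapsTo_ball
        hsys'.symm⟩
  refine ⟨ω₁, ω₂, hω₁, hω₂, hsys'.satisfiesRelation, hsys', fun v₁ v₂ h₁ h₂ h => ?_, huniq⟩
  obtain ⟨h3, h4⟩ := huniq v₁ v₂ h₁.isOpenDiskMap h₂.isOpenDiskMap h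
  have hcl : closedBall (0 : ℂ) 1 ⊆ closure (ball 0 1) := (closure_ball _ one_ne_zero).ge
  exact ⟨h3.of_subset_closure h₁.continuousOn hω₁.continuousOn ball_subset_closedBall hcl,
    h4.of_subset_closure h₂.continuousOn hω₂.continuousOn ball_subset_closedBall hcl⟩
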